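/- Let $T\colon\mathbf{Set}\to\mathbf{Set}$ be a functor and $\mathcal Q$ the contravariant powerset functor (acting on maps by preimage). An $n$-ary predicate lifting for $T$ is a natural transformation $\lambda\colon\mathcal Q^n\to\mathcal Q\circ T^{\mathrm{op}}$. It is monotone if every $\lambda_X$ preserves inclusion in every argument, and it preserves singletons if $|\lambda_X(\{x_1\},\dots,\{x_n\})|=1$ for every set $X$ and all $x_1,\dots,x_n\in X$. A set $\Lambda$ of predicate liftings is strongly expressive if for every set $X$ and every $t\in TX$ there are an $n$-ary $\lambda\in\Lambda$ and $x_1,\dots,x_n\in X$ with $\{t\}=\lambda_X(\{x_1\},\dots,\{x_n\})$. Let $\mathsf V$ be a set of fixed point variables and $\mathcal L$ a set of modalities with finite arities. To each $n$-ary $L\in\mathcal L$ let there be assigned an $n$-ary monotone, singleton-preserving predicate lifting $[\![L]\!]$ for $T$, such that $\{[\![L]\!]\mid L\in\mathcal L\}$ is strongly expressive. Expressions are given by $$\phi::=z\mid\nu z.\,\phi\mid L(\phi_1,\dots,\phi_n)\qquad(z\in\mathsf V,\ L\in\mathcal L\text{ of arity }n).$$ An expression is closed if it has no free variables, and guarded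 if every bound occurrence of a variable is separated from its binding operator $\nu z$ by at least one modality. In a $T$-coalgebra $C=(X,\xi\colon X\to TX)$ and for a valuation $\kappa\colon\mathsf V\to\mathcal QX$, the semantics is $$[\![z]\!]^\kappa_C=\kappa(z),\qquad [\![L(\phi_1,\dots,\phi_n)]\!]^\kappa_C=\xi^{-1}\big[[\![L]\!]_X([\![\phi_1]\!]^\kappa_C,\dots,[\![\phi_n]\!]^\kappa_C)\big],$$ and $[\![\nu z.\,\phi]\!]^\kappa_C$ is the greatest fixed point of the monotone map $Y\mapsto[\![\phi]\!]^{\kappa[z\mapsto Y]}_C$. For closed $\phi$ this does not depend on $\kappa$, and one writes $[\![\phi]\!]_C$. States $x$ of $C$ and $y$ of $D$ are behaviourally equivalent if there are a coalgebra $E$ and coalgebra morphisms $f\colon C\to E$, $g\colon D\to E$ with $f(x)=g(y)$. Theorem. Every closed and guarded expression $\phi$ describes exactly one behavioural equivalence class, and this class is realized in a finite coalgebra. Explicitly: there is a state $x$ in a finite $T$-coalgebra such that, for every $T$-coalgebra $C$, the set $[\![\phi]\!]_C$ consists precisely of the states of $C$ that are behaviourally equivalent to $x$. -/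

import Mathlib

open CategoryTheory

universe u v w

namespace CoalgExpr

/-- An `n`-ary predicate lifting for a set functor `T`: a natural transformation `𝒬ⁿ → 𝒬 ∘ Tᵒᵖ`,
where `𝒬` is the contravariant powerset functor (acting on maps by taking preimages). -/
structure PredicateLifting (T : Type u ⥤ Type u) (n : ℕ) where
  /-- The component of the lifting at a set `X`. -/
  app : ∀ X : Type u, (Fin n → Set X) → Set (T.obj X)
  /-- Naturality. -/
  naturality : ∀ {X Y : Type u} (f : X ⟶ Y) (B : Fin n → Set Y),
    app X (fun i => ⇑f ⁻¹' B i) = ⇑(T.map f) ⁻¹' app Y B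

/-- The lifting preserves set inclusion in every argument. -/
def PredicateLifting.IsMonotone {T : Type u ⥤ Type u} {n : ℕ} (l : PredicateLifting T n) : Prop :=
  ∀ X : Type u, Monotone (l.app X)

/-- `l.app X ({x₁}, …, {xₙ})` has exactly one element, for all `x₁, …, xₙ ∈ X`. -/
def PredicateLifting.PreservesSingletons {T : Type u ⥤ Type u} {n : ℕ}
    (l : PredicateLifting T n) : Prop :=
  ∀ (X : Type u) (x : Fin n → X), ∃ t : T.obj X, l.app X (fun i => {x i}) = {t}

/-- A set of predicate liftings (of arbitrary finite arities) is strongly expressive if every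
`t ∈ T X` satisfies `{t} = l.app X ({x₁}, …, {xₙ})` for some `l` in the set and some
`x₁, …, xₙ ∈ X`. -/
def StronglyExpressive {T : Type u ⥤ Type u} (Λ : Set (Σ n : ℕ, PredicateLifting T n)) : Prop :=
  ∀ (X : Type u) (t : T.obj X), ∃ l ∈ Λ, ∃ x : Fin l.1 → X,
    {t} = l.2.app X (fun i => {x i})

/-- Expressions `φ ::= z | ν z. φ | L (φ₁, …, φₙ)` over the set `V` of fixed point variables and
the set `M` of modalities with arity function `ar`. -/
inductive Expr (V : Type v) {M : Type w} (ar : M → ℕ) : Type (max v w)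
  | var (z : V) : Expr V ar
  | nu (z : V) (φ : Expr V ar) : Expr V ar
  | modal (L : M) (φ : Fin (ar L) → Expr V ar) : Expr V ar

namespace Expr

variable {V : Type v} {M : Type w} {ar : M → ℕ}

/-- The variables with a free occurrence. -/
def freeVars : Expr V ar → Set V
  | var z => {z}
  | nu z φ => φ.freeVars \ {z}
  | modal _ φ => ⋃ i, (φ i).freeVars

/-- The variables with a free occurrence that is not in the scope of a modality. -/
def unguardedVars : Expr V ar → Set V
  | var z => {z}
  | nu z φ => φ.unguardedVars \ {z}
  | modal _ _ => ∅

/-- All fixed point variables are bound by a fixed point operator. -/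
def Closed (φ : Expr V ar) : Prop := φ.freeVars = ∅

/-- Every bound occurrence of a variable is separated from its binding fixed point operator by at
least one modality. -/
def Guarded : Expr V ar → Prop
  | var _ => True
  | nu z φ => z ∉ φ.unguardedVars ∧ φ.Guarded
  | modal _ φ => ∀ i, (φ i).Guarded

end Expr

open Classical in
/-- The semantics of expressions in a `T`-coalgebra `C`, as a (monotone) map sending a valuation
`κ : V → 𝒬 C` to a set of states. The clause for `ν z. φ` is the greatest fixed point of the
monotone map `Y ↦ sem φ (κ[z ↦ Y])`. -/
noncomputable def sem {T : Type u ⥤ Type u} {V : Type v} {M : Type w} {ar : M → ℕ}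
    (I : ∀ L : M, PredicateLifting T (ar L)) (hI : ∀ L : M, (I L).IsMonotone)
    (C : Endofunctor.Coalgebra T) : Expr V ar → ((V → Set C.V) →o Set C.V)
  | .var z => ⟨fun κ => κ z, fun _ _ h => h z⟩
  | .nu z φ =>
      ⟨fun κ => OrderHom.gfp
          ⟨fun Y => sem I hI C φ (Function.update κ z Y),
            fun _ _ h => (sem I hI C φ).monotone (update_le_update_iff.2
              ⟨h, fun _ _ => le_rfl⟩)⟩,
        fun _ _ h => OrderHom.gfp.monotone fun _ => (sem I hI C φ).monotone
          (update_le_update_iff.2 ⟨le_rfl, fun j _ => h j⟩)⟩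
  | .modal L φ =>
      ⟨fun κ => ⇑C.str ⁻¹' (I L).app C.V (fun i => sem I hI C (φ i) κ),
        fun _ _ h => Set.preimage_mono (hI L C.V fun i => (sem I hI C (φ i)).monotone h)⟩

/-- States `x` of `C` and `y` of `D` are behaviourally equivalent if they are identified by some
pair of coalgebra morphisms `C ⟶ E ⟵ D`. -/
def BehaviourallyEquivalent {T : Type u ⥤ Type u} (C D : Endofunctor.Coalgebra T)
    (x : C.V) (y : D.V) : Prop :=
  ∃ (E : Endofunctor.Coalgebra T) (f : C ⟶ E) (g : D ⟶ E), f.f x = g.f y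

/-- Behavioural equivalence is an equivalence relation on states of (possibly distinct) coalgebras,
so that behavioural equivalence classes make sense. -/
theorem BehaviourallyEquivalent.refl {T : Type u ⥤ Type u} (C : Endofunctor.Coalgebra T)
    (x : C.V) : BehaviourallyEquivalent C C x x :=
  ⟨C, 𝟙 C, 𝟙 C, rfl⟩

theorem BehaviourallyEquivalent.symm {T : Type u ⥤ Type u} {C D : Endofunctor.Coalgebra T}
    {x : C.V} {y : D.V} : BehaviourallyEquivalent C D x y → BehaviourallyEquivalent D C y x :=
  fun ⟨E, f, g, h⟩ => ⟨E, g, f, h.symm⟩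

theorem BehaviourallyEquivalent.trans {T : Type u ⥤ Type u} {C D E : Endofunctor.Coalgebra T}
    {x : C.V} {y : D.V} {z : E.V} (h₁ : BehaviourallyEquivalent C D x y)
    (h₂ : BehaviourallyEquivalent D E y z) : BehaviourallyEquivalent C E x z := by
  obtain ⟨P, f, g, h⟩ := h₁
  obtain ⟨Q, f', g', h'⟩ := h₂
  -- amalgamate the two witnessing coalgebras along `D`
  let i := Limits.pushout.inl g.f f'.f
  let j := Limits.pushout.inr g.f f'.f
  have w : g.f ≫ i = f'.f ≫ j := Limits.pushout.condition
  have w' : g.f ≫ P.str ≫ T.map i = f'.f ≫ Q.str ≫ T.map j := by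
    rw [← Category.assoc, ← g.h, ← Category.assoc, ← f'.h, Category.assoc, Category.assoc,
      ← T.map_comp, ← T.map_comp, w]
  let R : Endofunctor.Coalgebra T := ⟨_, Limits.pushout.desc _ _ w'⟩
  let a : P ⟶ R := ⟨i, (Limits.pushout.inl_desc _ _ w').symm⟩
  let b : Q ⟶ R := ⟨j, (Limits.pushout.inr_desc _ _ w').symm⟩
  refine ⟨R, f ≫ a, g' ≫ b, ?_⟩
  have hw : i (g.f y) = j (f'.f y) := types_congr_hom w y
  change i (f.f x) = j (g'.f z)
  rw [h, hw, h']

end CoalgExpr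

namespace CoalgExpr

/-! ### Flat equation systems. -/

variable {V : Type v} {M : Type w}

/-! Compile `φ` into a finite system with one unknown per modality occurrence; binding `z` by `nu`
merely redirects references to `z` to the root, which guardedness keeps distinct from `z`. Nested
greatest fixed points then collapse to a simultaneous one: `⟦φ⟧` is the largest value at the root of
a post-fixed family (`elim_root_subset_sem`, `exists_isPostfixed_sem_eq`). If `φ` is closed, no
parameters remain, and singleton preservation turns the system into a finite coalgebra `F` on its
unknowns. Behavioural equivalence classes of states of `F` form a post-fixed family, and every
post-fixed family lies below it, because the pushout of the induced relation carries a coalgebra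
structure. -/

/-- A finite system of flat equations `p = L (q₁, …, qₙ)` whose right-hand sides may refer to the
unknowns of the system and to parameters from `V`, together with a distinguished reference. -/
structure FlatSystem (V : Type v) {M : Type w} (ar : M → ℕ) where
  /-- The unknowns of the system. -/
  Unknown : Type
  /-- There are finitely many unknowns. -/
  finite : Finite Unknown
  /-- The modality on the right-hand side. -/
  head : Unknown → M
  /-- The arguments of the modality. -/
  args : ∀ p, Fin (ar (head p)) → Unknown ⊕ V
  /-- The distinguished reference. -/
  root : Unknown ⊕ V

variable {ar : M → ℕ}

namespace FlatSystem

/-- `S` is a post-fixed point of the system in the coalgebra `C`, for the parameters `κ`. -/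
def IsPostfixed {T : Type u ⥤ Type u} (I : ∀ L : M, PredicateLifting T (ar L))
    (C : Endofunctor.Coalgebra T) (s : FlatSystem V ar) (κ : V → Set C.V)
    (S : s.Unknown → Set C.V) : Prop :=
  ∀ p, S p ⊆ ⇑C.str ⁻¹' (I (s.head p)).app C.V (fun k => Sum.elim S κ (s.args p k))

/-- The system without unknowns that refers to the parameter `z`. -/
def var (ar : M → ℕ) (z : V) : FlatSystem V ar where
  Unknown := Empty
  finite := inferInstance
  head := Empty.elim
  args p := p.elim
  root := .inr z

/-- The system obtained by applying a modality to the roots of the systems `s i`. -/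
def modal (L : M) (s : Fin (ar L) → FlatSystem V ar) : FlatSystem V ar where
  Unknown := Option (Σ i, (s i).Unknown)
  finite := by
    have := fun i => (s i).finite
    infer_instance
  head
    | none => L
    | some p => (s p.1).head p.2
  args
    | none => fun i => (s i).root.map (fun q => some ⟨i, q⟩) id
    | some p => fun k => ((s p.1).args p.2 k).map (fun q => some ⟨p.1, q⟩) id
  root := .inl none

open Classical in
/-- The system in which references to the parameter `z` are redirected to the root. -/
noncomputable def nu (z : V) (s : FlatSystem V ar) : FlatSystem V ar where
  Unknown := s.Unknown
  finite := s.finite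
  head := s.head
  args p k := if s.args p k = .inr z then s.root else s.args p k
  root := s.root

end FlatSystem

/-! ### Which parameters survive compilation. -/

namespace Expr

theorem unguardedVars_subset_freeVars (φ : Expr V ar) : φ.unguardedVars ⊆ φ.freeVars := by
  induction φ with
  | var z => exact subset_rfl
  | nu z φ ih => exact Set.sdiff_subset_sdiff_left ih
  | modal L φ ih => exact Set.empty_subset _

/-- The flat system of an expression. -/
noncomputable def toSystem : Expr V ar → FlatSystem V ar
  | var z => .var ar z
  | nu z φ => .nu z φ.toSystem
  | modal L φ => .modal L fun i => (φ i).toSystem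

/-- A modality makes the root an unknown, so a parameter at the root was reached through `nu` alone,
and guardedness says none of these bind it. -/
theorem mem_unguardedVars_of_root {φ : Expr V ar} (hφ : φ.Guarded) {z : V}
    (h : φ.toSystem.root = .inr z) : z ∈ φ.unguardedVars := by
  induction φ with
  | var w => exact (Sum.inr.inj h).symm
  | nu w φ ih =>
    have hz := ih hφ.2 h
    exact ⟨hz, fun e => hφ.1 (e ▸ hz)⟩
  | modal L φ ih => cases h

theorem root_ne {φ : Expr V ar} {z : V} (hφ : (nu z φ).Guarded) : φ.toSystem.root ≠ .inr z :=
  fun h => hφ.1 (mem_unguardedVars_of_root hφ.2 h)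

-- Ensures that a closed guarded expression yields a system whose arguments are all unknowns.
open Classical in
theorem mem_freeVars_of_args {φ : Expr V ar} (hφ : φ.Guarded) {z : V} {p : φ.toSystem.Unknown}
    {k : Fin (ar (φ.toSystem.head p))} (h : φ.toSystem.args p k = .inr z) : z ∈ φ.freeVars := by
  induction φ with
  | var w => exact p.elim
  | nu w φ ih =>
    change (if φ.toSystem.args p k = .inr w then φ.toSystem.root else φ.toSystem.args p k)
      = .inr z at h
    split_ifs at h with hw
    · exact unguardedVars_subset_freeVars _ (mem_unguardedVars_of_root (φ := nu w φ) hφ h)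
    · refine ⟨ih hφ.2 h, ?_⟩
      rintro rfl
      exact hw h
  | modal L φ ih =>
    refine Set.mem_iUnion.2 ?_
    cases p with
    | none =>
      change Sum.map _ _ (φ k).toSystem.root = _ at h
      refine ⟨k, unguardedVars_subset_freeVars _ (mem_unguardedVars_of_root (hφ k) ?_)⟩
      cases e : (φ k).toSystem.root with
      | inl q => rw [e] at h; cases h
      | inr w => rw [e] at h; exact congrArg Sum.inr (Sum.inr.inj h)
    | some p =>
      change Sum.map _ _ ((φ p.1).toSystem.args p.2 k) = _ at h
      refine ⟨p.1, ih p.1 (hφ p.1) (p := p.2) (k := k) ?_⟩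
      cases e : (φ p.1).toSystem.args p.2 k with
      | inl q => rw [e] at h; cases h
      | inr w => rw [e] at h; exact congrArg Sum.inr (Sum.inr.inj h)

end Expr

/-! ### Post-fixed families and the semantics. -/

variable {T : Type u ⥤ Type u} {I : ∀ L : M, PredicateLifting T (ar L)}
  {C : Endofunctor.Coalgebra T}

namespace FlatSystem

theorem isPostfixed_modal_iff {L : M} {s : Fin (ar L) → FlatSystem V ar} {κ : V → Set C.V}
    {S : (modal L s).Unknown → Set C.V} :
    IsPostfixed I C (modal L s) κ S ↔
      S none ⊆ ⇑C.str ⁻¹'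
        (I L).app C.V (fun i => Sum.elim (fun q => S (some ⟨i, q⟩)) κ (s i).root) ∧
      ∀ i, IsPostfixed I C (s i) κ (fun q => S (some ⟨i, q⟩)) := by
  have key (i) (r : (s i).Unknown ⊕ V) :
      Sum.elim S κ (r.map (fun q => some ⟨i, q⟩) id) = Sum.elim (fun q => S (some ⟨i, q⟩)) κ r := by
    cases r <;> rfl
  simp only [IsPostfixed, ← key]
  exact ⟨fun h => ⟨h none, fun i p => h (some ⟨i, p⟩)⟩, fun h p => match p with
    | none => h.1
    | some ⟨i, p⟩ => h.2 i p⟩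

-- Redirecting `z` to the root amounts to interpreting `z` by the root's own value.
open Classical in
theorem isPostfixed_nu_iff {z : V} {s : FlatSystem V ar} (hz : s.root ≠ .inr z) {κ : V → Set C.V}
    {S : s.Unknown → Set C.V} :
    IsPostfixed I C (nu z s) κ S ↔
      IsPostfixed I C s (Function.update κ z (Sum.elim S κ s.root)) S := by
  refine forall_congr' fun p => ?_
  have key (r : s.Unknown ⊕ V) : Sum.elim S κ (if r = .inr z then s.root else r) =
      Sum.elim S (Function.update κ z (Sum.elim S κ s.root)) r := by
    rcases r with q | w
    · simp
    · by_cases h : w = z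
      · subst h; simp
      · simp [h]
  simp only [← key]
  rfl

open Classical in
theorem elim_update_root {z : V} {s : FlatSystem V ar} (hz : s.root ≠ .inr z) {κ : V → Set C.V}
    (S : s.Unknown → Set C.V) (Y : Set C.V) :
    Sum.elim S (Function.update κ z Y) s.root = Sum.elim S κ s.root := by
  rcases h : s.root with q | w
  · rfl
  · have : w ≠ z := fun e => hz (e ▸ h)
    simp [this]

end FlatSystem

open FlatSystem

/-- Coinduction: under `nu z`, the root value is itself a post-fixed point of the map whose greatest
fixed point is taken. -/
theorem elim_root_subset_sem (hI : ∀ L : M, (I L).IsMonotone) {φ : Expr V ar} (hφ : φ.Guarded)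
    {κ : V → Set C.V} {S : φ.toSystem.Unknown → Set C.V} (hS : IsPostfixed I C φ.toSystem κ S) :
    Sum.elim S κ φ.toSystem.root ⊆ sem I hI C φ κ := by
  classical
  induction φ generalizing κ with
  | var z => exact subset_rfl
  | nu z φ ih =>
    change φ.toSystem.Unknown → Set C.V at S
    refine OrderHom.le_gfp _ ?_
    have h := ih hφ.2 ((isPostfixed_nu_iff (Expr.root_ne hφ)).1 hS)
    exact (elim_update_root (Expr.root_ne hφ) S _).ge.trans h
  | modal L φ ih =>
    obtain ⟨h₀, h⟩ := isPostfixed_modal_iff.1 hS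
    exact h₀.trans (Set.preimage_mono (hI L C.V fun i => ih i (hφ i) (h i)))

theorem exists_isPostfixed_sem_eq (hI : ∀ L : M, (I L).IsMonotone) {φ : Expr V ar}
    (hφ : φ.Guarded) (κ : V → Set C.V) :
    ∃ S, IsPostfixed I C φ.toSystem κ S ∧ Sum.elim S κ φ.toSystem.root = sem I hI C φ κ := by
  classical
  induction φ generalizing κ with
  | var z => exact ⟨Empty.elim, fun p => p.elim, rfl⟩
  | nu z φ ih =>
    set Y := sem I hI C (.nu z φ) κ with hY
    -- Unfolding the fixed point makes the root value of the body's family equal to `Y`, the value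
    -- assumed for `z`.
    have hfix : sem I hI C φ (Function.update κ z Y) = Y := by
      convert OrderHom.map_gfp (⟨fun Y => sem I hI C φ (Function.update κ z Y), fun _ _ h =>
        (sem I hI C φ).monotone (update_le_update_iff.2 ⟨h, fun _ _ => le_rfl⟩)⟩ :
          Set C.V →o Set C.V) using 1
      · simp only [hY, sem]
        congr!
      · simp only [hY, sem]
        congr!
    obtain ⟨S, hS, h⟩ := ih hφ.2 (Function.update κ z Y)
    rw [elim_update_root (Expr.root_ne hφ), hfix] at h
    exact ⟨S, (isPostfixed_nu_iff (Expr.root_ne hφ)).2 (h.symm ▸ hS), h⟩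
  | modal L φ ih =>
    choose S hS h using fun i => ih i (hφ i) κ
    refine ⟨fun p => p.elim (sem I hI C (.modal L φ) κ) fun q => S q.1 q.2,
      isPostfixed_modal_iff.2 ⟨?_, hS⟩, rfl⟩
    exact Set.preimage_mono (hI L C.V fun i => (h i).ge)

/-! ### Flat coalgebras and behavioural equivalence. -/

section Coalgebra

variable {F : Endofunctor.Coalgebra T} {head : F.V → M} {args : ∀ p, Fin (ar (head p)) → F.V}

/-- A family of sets that is post-fixed for the flat equations describing the coalgebra `F`
consists of states behaviourally equivalent to the respective states of `F`. -/
theorem behaviourallyEquivalent_of_mem_postfixed (hI : ∀ L : M, (I L).IsMonotone)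
    (hsing : ∀ L : M, (I L).PreservesSingletons)
    (hF : ∀ p, F.str p ∈ (I (head p)).app F.V (fun k => {args p k}))
    {S : F.V → Set C.V}
    (hS : ∀ p, S p ⊆ ⇑C.str ⁻¹' (I (head p)).app C.V (fun k => S (args p k)))
    {p : F.V} {y : C.V} (hy : y ∈ S p) : BehaviourallyEquivalent C F y p := by
  -- The pushout of the projections of `R` identifies each `x ∈ S q` with `q`.
  let R : Type u := {r : C.V × F.V // r.1 ∈ S r.2}
  let a : R ⟶ C.V := ↾fun r => r.1.1
  let b : R ⟶ F.V := ↾fun r => r.1.2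
  let i := Limits.pushout.inl a b
  let j := Limits.pushout.inr a b
  have w : a ≫ i = b ≫ j := Limits.pushout.condition
  have hw {q : F.V} {x : C.V} (hx : x ∈ S q) : i x = j q :=
    types_congr_hom w (⟨(x, q), hx⟩ : R)
  have w' : a ≫ C.str ≫ T.map i = b ≫ F.str ≫ T.map j := by
    ext ⟨⟨x, q⟩, hx⟩
    -- Both successors land in the lifting of the same singletons, which has just one element; so
    -- they agree and the pushout inherits a structure map.
    obtain ⟨t, ht⟩ := hsing (head q) _ fun k => j (args q k)
    have h₁ : C.str x ∈ ⇑(T.map i) ⁻¹' (I (head q)).app _ (fun k => {j (args q k)}) := by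
      rw [← PredicateLifting.naturality]
      exact hI (head q) _ (fun k z (hz : z ∈ S (args q k)) => hw hz) (hS q hx)
    have h₂ : F.str q ∈ ⇑(T.map j) ⁻¹' (I (head q)).app _ (fun k => {j (args q k)}) := by
      rw [← PredicateLifting.naturality]
      exact hI _ _ (fun k z hz => congrArg j hz) (hF q)
    rw [ht] at h₁ h₂
    exact h₁.trans h₂.symm
  let E : Endofunctor.Coalgebra T := ⟨_, Limits.pushout.desc _ _ w'⟩
  exact ⟨E, ⟨i, (Limits.pushout.inl_desc _ _ w').symm⟩, ⟨j, (Limits.pushout.inr_desc _ _ w').symm⟩,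
    hw hy⟩

/-- The behavioural equivalence classes of the states of a coalgebra `F` that is described by flat
equations are post-fixed for these equations. -/
theorem setOf_behaviourallyEquivalent_subset (hI : ∀ L : M, (I L).IsMonotone)
    (hF : ∀ p, F.str p ∈ (I (head p)).app F.V (fun k => {args p k})) (p : F.V) :
    {y | BehaviourallyEquivalent C F y p} ⊆ ⇑C.str ⁻¹' (I (head p)).app C.V
      (fun k => {y | BehaviourallyEquivalent C F y (args p k)}) := by
  rintro y ⟨E, f, g, h⟩
  have hf : T.map f.f (C.str y) = E.str (f.f y) := types_congr_hom f.h y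
  have hg : T.map g.f (F.str p) = E.str (g.f p) := types_congr_hom g.h p
  have h₂ : F.str p ∈ ⇑(T.map g.f) ⁻¹' (I (head p)).app _ (fun k => {g.f (args p k)}) := by
    rw [← PredicateLifting.naturality]
    exact hI _ _ (fun k z hz => congrArg g.f hz) (hF p)
  have h₁ : C.str y ∈ ⇑(T.map f.f) ⁻¹' (I (head p)).app _ (fun k => {g.f (args p k)}) := by
    rw [Set.mem_preimage, hf, h, ← hg]
    exact h₂
  rw [← PredicateLifting.naturality] at h₁
  refine hI _ _ (fun k z hz => ?_) h₁
  -- The fibre of `f` over `g.f (args p k)` is witnessed by the same cospan.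
  exact ⟨E, f, g, hz⟩

end Coalgebra

end CoalgExpr

theorem mainTheorem1 (T : Type u ⥤ Type u)
    {V : Type v} {M : Type w} (ar : M → ℕ)
    (I : ∀ L : M, CoalgExpr.PredicateLifting T (ar L))
    (hmono : ∀ L : M, (I L).IsMonotone)
    (hsing : ∀ L : M, (I L).PreservesSingletons)
    (hexpr : CoalgExpr.StronglyExpressive
      (Set.range fun L : M => (⟨ar L, I L⟩ : Σ n : ℕ, CoalgExpr.PredicateLifting T n)))
    (φ : CoalgExpr.Expr V ar) (hclosed : φ.Closed) (hguarded : φ.Guarded) :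
    ∃ (F : Endofunctor.Coalgebra T) (_ : Finite F.V) (x : F.V),
      ∀ (C : Endofunctor.Coalgebra T) (κ : V → Set C.V),
        CoalgExpr.sem I hmono C φ κ =
          {y : C.V | CoalgExpr.BehaviourallyEquivalent C F y x} := by
  have hfree (z : V) : z ∉ φ.freeVars := by simp [show φ.freeVars = ∅ from hclosed]
  obtain ⟨r, hr⟩ : ∃ r, φ.toSystem.root = .inl r := by
    rcases h : φ.toSystem.root with r | z
    · exact ⟨r, rfl⟩
    · exact absurd (CoalgExpr.Expr.unguardedVars_subset_freeVars _
        (CoalgExpr.Expr.mem_unguardedVars_of_root hguarded h)) (hfree z)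
  have hargs : ∀ p k, ∃ q, φ.toSystem.args p k = .inl q := fun p k => by
    rcases h : φ.toSystem.args p k with q | z
    · exact ⟨q, rfl⟩
    · exact absurd (CoalgExpr.Expr.mem_freeVars_of_args hguarded h) (hfree z)
  choose args hargs using hargs
  -- The successor of `p` is the unique element of the lifting at the singletons of its arguments;
  -- `ULift` moves the unknowns to the universe of `T`.
  choose str hstr using fun p : ULift.{u} φ.toSystem.Unknown =>
    hsing (φ.toSystem.head p.down) _ fun k => (ULift.up (args p.down k) : ULift.{u} _)
  let F : Endofunctor.Coalgebra T := ⟨ULift.{u} φ.toSystem.Unknown, ↾str⟩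
  have hF (p : F.V) : F.str p ∈ (I (φ.toSystem.head p.down)).app F.V
      (fun k => {ULift.up (args p.down k)}) := by
    rw [hstr p]
    rfl
  have hfin : Finite φ.toSystem.Unknown := φ.toSystem.finite
  refine ⟨F, inferInstanceAs (Finite (ULift φ.toSystem.Unknown)), ⟨r⟩, fun C κ => ?_⟩
  apply subset_antisymm
  · obtain ⟨S, hS, h⟩ := CoalgExpr.exists_isPostfixed_sem_eq (C := C) hmono hguarded κ
    rw [← h, hr]
    intro y hy
    refine CoalgExpr.behaviourallyEquivalent_of_mem_postfixed hmono hsing hF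
      (S := fun p => S p.down) (fun p => ?_) hy
    simpa only [hargs, Sum.elim_inl] using hS p.down
  · have h := CoalgExpr.elim_root_subset_sem (C := C) (κ := κ) hmono hguarded
      (S := fun p => {y | CoalgExpr.BehaviourallyEquivalent C F y ⟨p⟩}) fun p => by
        simpa only [hargs, Sum.elim_inl] using
          CoalgExpr.setOf_behaviourallyEquivalent_subset hmono hF ⟨p⟩
    rwa [hr] at h
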